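/- Let $d\ge 2$. For $\gamma>0$ and a measurable function $h$ on $\mathbb R^d$ (with Lebesgue measure) let $$\|h\|_{G\psi_\gamma}=\sup_{p\ge 1}\frac{|h|_p}{p^{\gamma}},\qquad |h|_p=\Big(\int_{\mathbb R^d}|h(x)|^p\,dx\Big)^{1/p},$$ and write $h\in G\psi_\gamma$ if this norm is finite. For measurable real or complex functions $f_1,\dots,f_d$ on $\mathbb R^d$ let $$M_R[f_1,\dots,f_d](x)=\sup_{R\ni x}\ \prod_{i=1}^d \frac1{|R|}\int_R|f_i(y)|\,dy ,$$ the supremum being over all non-degenerate bounded rectangles $R\subset\mathbb R^d$ with sides parallel to the coordinate axes and $x\in R$. There are constants $C_1(d),C_2(d)\in(0,\infty)$, depending only on $d$, such that for every $\gamma>0$ the following hold. (i) For every $p\ge1$ the minimum of $\prod_{i=1}^d \frac{p_i^{\gamma+1}}{p_i-1}$ over all $p_1,\dots,p_d\in(1,\infty)$ with $\sum_{i=1}^d \frac1{p_i}=\frac1p$ exists, and it satisfies $$Z(d,\gamma,p)=\Big(\frac{(dp)^{\gamma+1}}{dp-1}\Big)^{d}\le C_1(d)\,d^{d\gamma}\,p^{d(\gamma+1)}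 ,$$ where $Z(d,\gamma,p)$ denotes this minimum. (ii) If $f_1,\dots,f_d\in G\psi_\gamma$ and $g=M_R[f_1,\dots,f_d]$, then $g$ is finite almost everywhere, $g\in G\psi_{d(\gamma+1)}$, and for every $p\ge 1$ $$|g|_p\le C_2(d)\,Z(d,\gamma,p)\prod_{i=1}^d\|f_i\|_{G\psi_\gamma},\qquad |g|_p\le C_2(d)\,d^{d\gamma}\,p^{d(\gamma+1)}\prod_{i=1}^d\|f_i\|_{G\psi_\gamma};$$ consequently $$\|g\|_{G\psi_{d(\gamma+1)}}\le C_2(d)\,d^{d\gamma}\prod_{i=1}^d\|f_i\|_{G\psi_\gamma}.$$ In particular, for fixed $\gamma$ the norm of $g$ is at most a constant times $\prod_{i=1}^d\|f_i\|_{G\psi_\gamma}$. -/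

import Mathlib

open MeasureTheory
open scoped ENNReal

noncomputable section

/-- The (extended-valued) Grand Lebesgue norm `sup_{p ∈ I} |f|_p / ψ(p)` of `f` with respect to
the generating function `ψ` given on the interval `I ⊆ [1, ∞)`. The target only needs an extended
norm, so that real, complex and `[0, ∞]`-valued functions are covered. -/
def glsNorm {Z ε : Type*} [MeasurableSpace Z] [ENorm ε] (I : Set ℝ) (ψ : ℝ → ℝ)
    (f : Z → ε) (ν : Measure Z) : ℝ≥0∞ :=
  ⨆ p ∈ I, eLpNorm f (ENNReal.ofReal p) ν / ENNReal.ofReal (ψ p)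

/-- The norm of `Gψ_γ`, where `ψ_γ(p) = p ^ γ` for `p ∈ [1, ∞)`. -/
def glsPowNorm {Z ε : Type*} [MeasurableSpace Z] [ENorm ε] (γ : ℝ)
    (f : Z → ε) (ν : Measure Z) : ℝ≥0∞ :=
  glsNorm (Set.Ici 1) (fun p => p ^ γ) f ν

/-- Membership in `Gψ_γ`: measurable (up to a null set) with finite `Gψ_γ` norm. -/
def MemGLSPow {Z ε : Type*} [MeasurableSpace Z] [TopologicalSpace ε] [ENorm ε] (γ : ℝ)
    (f : Z → ε) (ν : Measure Z) : Prop :=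
  AEStronglyMeasurable f ν ∧ glsPowNorm γ f ν < ∞

/-- The non-degenerate bounded open rectangles of `ℝ^d` with sides parallel to the axes.
(For locally integrable functions, closed or half-open rectangles give the same maximal
function: a box and its closure have the same averages, and a closed box is the decreasing
limit of open boxes containing it.) -/
def axisRectangles (d : ℕ) : Set (Set (Fin d → ℝ)) :=
  {R | ∃ a b : Fin d → ℝ, (∀ i, a i < b i) ∧ R = Set.univ.pi fun i => Set.Ioo (a i) (b i)}

/-- The multilinear strong maximal operator
`M_R[f_1, …, f_d](x) = sup_{R ∋ x} ∏_i |R|⁻¹ ∫_R |f_i(y)| dy`, with values in `[0, ∞]`. -/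
def strongMaximal {𝕜 : Type*} [ENorm 𝕜] {d : ℕ} (f : Fin d → (Fin d → ℝ) → 𝕜)
    (x : Fin d → ℝ) : ℝ≥0∞ :=
  ⨆ R ∈ {R ∈ axisRectangles d | x ∈ R}, ∏ i, ((volume R)⁻¹ * ∫⁻ y in R, ‖f i y‖ₑ)

/-- The values of `∏ p_i^(γ+1) / (p_i - 1)` over all exponents `p_1, …, p_d ∈ (1, ∞)` with
`∑ 1/p_i = 1/p`. -/
def extremalValues (d : ℕ) (γ p : ℝ) : Set ℝ :=
  {z | ∃ q : Fin d → ℝ, (∀ i, 1 < q i) ∧ ∑ i, 1 / q i = 1 / p ∧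
    z = ∏ i, (q i ^ (γ + 1) / (q i - 1))}

end

/-! The operator maps `L^{dp} × ⋯ × L^{dp}` to `L^p` with a constant independent of `p ≥ 1`, and a
single `L²` bound is enough for this. Put `q = dp/2`, which is at least 1 because `d ≥ 2`. By
Jensen, the `q`-th power of an average of `|f_i|` is at most the average of `|f_i|^q`. Averages over
boxes are iterated averages over intervals, so they are dominated by successive one-dimensional
maximal functions, each bounded on `L²` (Vitali covering, weak type (1,1), truncation). The majorant
`g_i` then satisfies `∫ g_i² ≤ 320^d ∫ |f_i|^{dp}`, and Hölder with `d` equal weights combines the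
factors (`lintegral_strongMaximal_rpow_le`).

Since `|f_i|_{dp} ≤ (dp)^γ ‖f_i‖`, this gives the factor `(dp)^{γd}`, which is at most `Z` because
`dp/(dp-1) ≥ 1`. The value of `Z` itself comes from AM-GM in the variables `1/p_i`. -/

/-! ### Maximal function on the line: weak (1,1) and strong (2,2) bounds. -/

/-- The uncentered maximal function on the line, the supremum being over the intervals with
rational end points. -/
noncomputable def intervalMax (f : ℝ → ℝ≥0∞) (t : ℝ) : ℝ≥0∞ :=
  ⨆ p : ℚ × ℚ, (Set.Ioo (p.1 : ℝ) p.2).indicator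
    (fun _ => (ENNReal.ofReal (p.2 - p.1))⁻¹ * ∫⁻ s in Set.Ioo (p.1 : ℝ) p.2, f s) t

theorem measurable_intervalMax (f : ℝ → ℝ≥0∞) : Measurable (intervalMax f) :=
  Measurable.iSup fun _ => measurable_const.indicator measurableSet_Ioo

/-- Averaging is additive and fixes constants. This allows the part of a function below a given
height to be discarded in the truncation argument. -/
theorem intervalMax_le_add {f g : ℝ → ℝ≥0∞} {c : ℝ≥0∞} (hg : Measurable g)
    (h : ∀ t, f t ≤ g t + c) (t : ℝ) : intervalMax f t ≤ intervalMax g t + c := by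
  refine iSup_le fun p => ?_
  by_cases ht : t ∈ Set.Ioo (p.1 : ℝ) p.2
  · rw [Set.indicator_of_mem ht]
    have hpos : 0 < (p.2 : ℝ) - p.1 := by linarith [ht.1, ht.2]
    have h1 : ∫⁻ s in Set.Ioo (p.1 : ℝ) p.2, f s ≤
        (∫⁻ s in Set.Ioo (p.1 : ℝ) p.2, g s) + c * ENNReal.ofReal (p.2 - p.1) := by
      calc _ ≤ ∫⁻ s in Set.Ioo (p.1 : ℝ) p.2, (g s + c) := lintegral_mono h
        _ = _ := by rw [lintegral_add_left hg]; simp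
    calc _ ≤ (ENNReal.ofReal (p.2 - p.1))⁻¹ *
          ((∫⁻ s in Set.Ioo (p.1 : ℝ) p.2, g s) + c * ENNReal.ofReal (p.2 - p.1)) := by gcongr
      _ = (ENNReal.ofReal (p.2 - p.1))⁻¹ * (∫⁻ s in Set.Ioo (p.1 : ℝ) p.2, g s) + c := by
          rw [mul_add, mul_comm c, ← mul_assoc _ _ c,
            ENNReal.inv_mul_cancel (by simpa using hpos) ENNReal.ofReal_ne_top, one_mul]
      _ ≤ _ := by
          gcongr
          refine le_iSup_of_le p ?_
          rw [Set.indicator_of_mem ht]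
  · rw [Set.indicator_of_notMem ht]; exact zero_le

/-- The weak type (1,1) estimate for the maximal function on the line. -/
theorem mul_volume_lt_intervalMax_le (f : ℝ → ℝ≥0∞) {c : ℝ≥0∞} (hc : c ≠ 0) (hc' : c ≠ ∞) :
    c * volume {t | c < intervalMax f t} ≤ 5 * ∫⁻ s, f s := by
  by_cases hf : ∫⁻ s, f s = ∞
  · rw [hf]; simp
  let T : Set (ℚ × ℚ) := {p | (p.1 : ℝ) < p.2 ∧
    c * ENNReal.ofReal (p.2 - p.1) ≤ ∫⁻ s in Set.Ioo (p.1 : ℝ) p.2, f s}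
  let x : ℚ × ℚ → ℝ := fun p => ((p.1 : ℝ) + p.2) / 2
  let r : ℚ × ℚ → ℝ := fun p => ((p.2 : ℝ) - p.1) / 2
  -- The covering lemma needs bounded radii; this is where finiteness of `∫ f` enters.
  have hr : ∀ p ∈ T, r p ≤ ((∫⁻ s, f s) / c).toReal := by
    rintro p ⟨hp, hp'⟩
    have h1 : ENNReal.ofReal (p.2 - p.1) ≤ (∫⁻ s, f s) / c := by
      rw [ENNReal.le_div_iff_mul_le (Or.inl hc) (Or.inl hc'), mul_comm]
      exact hp'.trans (setLIntegral_le_lintegral _ _)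
    have h2 := (ENNReal.ofReal_le_iff_le_toReal (ENNReal.div_ne_top hf hc)).1 h1
    simp only [r]; linarith
  obtain ⟨U, hUT, hdisj, hcov⟩ := Vitali.exists_disjoint_subfamily_covering_enlargement_closedBall
    T x r _ hr 5 (by norm_num)
  have hIoo (p : ℚ × ℚ) : Set.Ioo (p.1 : ℝ) p.2 ⊆ Metric.closedBall (x p) (r p) := by
    intro t ht
    rw [Real.closedBall_eq_Icc]
    simp only [x, r]
    constructor <;> linarith [ht.1, ht.2]
  have hsub : {t | c < intervalMax f t} ⊆ ⋃ p ∈ U, Metric.closedBall (x p) (5 * r p) := by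
    intro t ht
    obtain ⟨p, hp⟩ := lt_iSup_iff.1 (show c < intervalMax f t from ht)
    by_cases htp : t ∈ Set.Ioo (p.1 : ℝ) p.2
    · rw [Set.indicator_of_mem htp] at hp
      have hpos : (p.1 : ℝ) < p.2 := htp.1.trans htp.2
      have hpT : p ∈ T := by
        refine ⟨hpos, ?_⟩
        rw [mul_comm c]
        calc _ ≤ ENNReal.ofReal (p.2 - p.1) * ((ENNReal.ofReal (p.2 - p.1))⁻¹ *
              ∫⁻ s in Set.Ioo (p.1 : ℝ) p.2, f s) := by gcongr
          _ = _ := by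
            rw [← mul_assoc, ENNReal.mul_inv_cancel (by simpa using hpos) ENNReal.ofReal_ne_top,
              one_mul]
      obtain ⟨q, hq, hpq⟩ := hcov p hpT
      exact Set.mem_biUnion hq (hpq (hIoo p htp))
    · rw [Set.indicator_of_notMem htp] at hp
      exact absurd hp not_lt_zero
  have hdisj' : U.PairwiseDisjoint fun p : ℚ × ℚ => Set.Ioo (p.1 : ℝ) p.2 :=
    hdisj.mono fun p => hIoo p
  calc c * volume {t | c < intervalMax f t}
      ≤ c * ∑' p : U, volume (Metric.closedBall (x p) (5 * r p)) := by
        gcongr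
        exact (measure_mono hsub).trans (measure_biUnion_le _ U.to_countable _)
    _ = ∑' p : U, 5 * (c * ENNReal.ofReal ((p : ℚ × ℚ).2 - (p : ℚ × ℚ).1)) := by
        rw [← ENNReal.tsum_mul_left]
        refine tsum_congr fun p => ?_
        rw [Real.volume_closedBall, show 2 * (5 * r p) =
          5 * (((p : ℚ × ℚ).2 : ℝ) - (p : ℚ × ℚ).1) by simp only [r]; ring,
          ENNReal.ofReal_mul (by norm_num)]
        simp only [ENNReal.ofReal_ofNat]
        ring
    _ ≤ ∑' p : U, 5 * ∫⁻ s in Set.Ioo ((p : ℚ × ℚ).1 : ℝ) (p : ℚ × ℚ).2, f s := by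
        gcongr with p
        exact (hUT p.2).2
    _ = 5 * ∫⁻ s in ⋃ p ∈ U, Set.Ioo ((p : ℚ × ℚ).1 : ℝ) (p : ℚ × ℚ).2, f s := by
        rw [ENNReal.tsum_mul_left,
          lintegral_biUnion U.to_countable (fun _ _ => measurableSet_Ioo) hdisj']
    _ ≤ _ := by
        gcongr 5 * ?_
        exact setLIntegral_le_lintegral _ _

/-- A layer-cake bound with a non-optimal constant: for `a ≤ y` the interval `(a/2, a)` alone
contributes at least `(a/2)²`. -/
theorem sq_le_lintegral_indicator_lt (y : ℝ≥0∞) :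
    y ^ 2 ≤ 4 * ∫⁻ t in Set.Ioi (0 : ℝ), ENNReal.ofReal t *
      {t : ℝ | ENNReal.ofReal t < y}.indicator 1 t := by
  have key : ∀ a : ℝ, 0 < a → ENNReal.ofReal a ≤ y → ENNReal.ofReal a ^ 2 ≤
      4 * ∫⁻ t in Set.Ioi (0 : ℝ), ENNReal.ofReal t *
        {t : ℝ | ENNReal.ofReal t < y}.indicator 1 t := by
    intro a ha hay
    calc ENNReal.ofReal a ^ 2 = 4 * (ENNReal.ofReal (a / 2) * volume (Set.Ioo (a / 2) a)) := by
          rw [Real.volume_Ioo, ← ENNReal.ofReal_mul (by positivity), ← ENNReal.ofReal_pow ha.le,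
            ← ENNReal.ofReal_ofNat, ← ENNReal.ofReal_mul (by norm_num)]
          congr 1; ring
      _ = 4 * ∫⁻ t in Set.Ioo (a / 2) a, ENNReal.ofReal (a / 2) := by simp
      _ ≤ 4 * ∫⁻ t in Set.Ioo (a / 2) a, ENNReal.ofReal t *
            {t : ℝ | ENNReal.ofReal t < y}.indicator 1 t := by
          gcongr 4 * ?_
          refine setLIntegral_mono' measurableSet_Ioo fun t ht => ?_
          rw [Set.indicator_of_mem]
          · simpa using ENNReal.ofReal_le_ofReal ht.1.le
          · exact ((ENNReal.ofReal_lt_ofReal_iff ha).2 ht.2).trans_le hay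
      _ ≤ _ := by
          gcongr 4 * ?_
          exact lintegral_mono_set fun t ht => lt_trans (by positivity) ht.1
  rcases eq_or_ne y 0 with rfl | h0
  · simp
  rcases eq_or_ne y ∞ with rfl | htop
  -- For `y = ∞` the bound `key` holds at every finite height, so the right side exceeds every `n +
  -- 1`.
  · have : (∞ : ℝ≥0∞) ^ 2 = ⨆ n : ℕ, ((n : ℝ≥0∞) + 1) := by
      rw [← ENNReal.iSup_add, ENNReal.iSup_natCast]; simp
    rw [this]
    refine iSup_le fun n => le_trans ?_ (key ((n : ℝ) + 1) (by positivity) le_top)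
    rw [ENNReal.ofReal_add (by positivity) (by norm_num)]
    simp only [ENNReal.ofReal_natCast, ENNReal.ofReal_one]
    exact le_self_pow (by simp) two_ne_zero
  · have := key y.toReal (ENNReal.toReal_pos h0 htop) (ENNReal.ofReal_toReal htop).le
    rwa [ENNReal.ofReal_toReal htop] at this

theorem volume_ofReal_lt_le (y : ℝ≥0∞) :
    ∫⁻ t in Set.Ioi (0 : ℝ), {t : ℝ | ENNReal.ofReal t < y}.indicator 1 t ≤ y := by
  rcases eq_or_ne y ∞ with rfl | htop
  · exact le_top
  have hm : MeasurableSet {t : ℝ | ENNReal.ofReal t < y} :=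
    measurableSet_lt ENNReal.measurable_ofReal measurable_const
  rw [lintegral_indicator_one hm, Measure.restrict_apply hm]
  calc _ ≤ volume (Set.Ioo 0 y.toReal) := by
        refine measure_mono fun t ht => ⟨ht.2, ?_⟩
        exact (ENNReal.ofReal_lt_iff_lt_toReal (le_of_lt ht.2) htop).1 ht.1
    _ = y := by simp [ENNReal.ofReal_toReal htop]

/-- The strong type (2,2) estimate for the maximal function on the line. -/
theorem lintegral_intervalMax_sq_le {f : ℝ → ℝ≥0∞} (hf : Measurable f) :
    ∫⁻ s, intervalMax f s ^ 2 ≤ 80 * ∫⁻ s, f s ^ 2 := by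
  have hM := measurable_intervalMax f
  have hind {g : ℝ → ℝ≥0∞} (hg : Measurable g) : Measurable fun z : ℝ × ℝ =>
      {t : ℝ | ENNReal.ofReal t < g z.1}.indicator (1 : ℝ → ℝ≥0∞) z.2 := by
    have : MeasurableSet {z : ℝ × ℝ | ENNReal.ofReal z.2 < g z.1} :=
      measurableSet_lt (by fun_prop) (by fun_prop)
    exact (measurable_one.indicator this : Measurable
      ({z : ℝ × ℝ | ENNReal.ofReal z.2 < g z.1}.indicator (1 : ℝ × ℝ → ℝ≥0∞)))
  have h2f : Measurable fun s => 2 * f s := hf.const_mul 2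
  have hlevel : ∀ t : ℝ, 0 < t →
      ∫⁻ s, ENNReal.ofReal t * {t : ℝ | ENNReal.ofReal t < intervalMax f s}.indicator 1 t
      ≤ 10 * ∫⁻ s, f s * {t : ℝ | ENNReal.ofReal t < 2 * f s}.indicator 1 t := by
    intro t ht
    -- Truncation at height `t/2`: as `f ≤ g + t/2`, the maximal function of `f` exceeds `t` only
    -- where that of `g` exceeds `t/2`.
    let g : ℝ → ℝ≥0∞ := fun s => f s * {t : ℝ | ENNReal.ofReal t < 2 * f s}.indicator 1 t
    have hg : Measurable g := hf.mul ((hind h2f).comp (measurable_id.prodMk measurable_const))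
    have hc : ENNReal.ofReal t = 2 * ENNReal.ofReal (t / 2) := by
      rw [← ENNReal.ofReal_ofNat, ← ENNReal.ofReal_mul (by norm_num)]
      congr 1; ring
    have hfg (s : ℝ) : f s ≤ g s + ENNReal.ofReal (t / 2) := by
      by_cases h : ENNReal.ofReal t < 2 * f s
      · simp [g, h]
      · rw [hc, not_lt, ENNReal.mul_le_mul_iff_right (by simp) (by simp)] at h
        exact h.trans le_add_self
    have hsub : {s | ENNReal.ofReal t < intervalMax f s} ⊆
        {s | ENNReal.ofReal (t / 2) < intervalMax g s} := by
      intro s hs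
      have h1 : ENNReal.ofReal t < intervalMax g s + ENNReal.ofReal (t / 2) :=
        lt_of_lt_of_le hs (intervalMax_le_add hg hfg s)
      rw [hc, two_mul] at h1
      exact lt_of_add_lt_add_right h1
    have hmeas : MeasurableSet {s | ENNReal.ofReal t < intervalMax f s} :=
      measurableSet_lt measurable_const hM
    calc ∫⁻ s, ENNReal.ofReal t * {t : ℝ | ENNReal.ofReal t < intervalMax f s}.indicator 1 t
        = ∫⁻ s, ENNReal.ofReal t * {s | ENNReal.ofReal t < intervalMax f s}.indicator 1 s := rfl
      _ = 2 * (ENNReal.ofReal (t / 2) * volume {s | ENNReal.ofReal t < intervalMax f s}) := by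
          rw [lintegral_const_mul _ (measurable_one.indicator hmeas),
            lintegral_indicator_one hmeas, ← mul_assoc, ← hc]
      _ ≤ 2 * (ENNReal.ofReal (t / 2) * volume {s | ENNReal.ofReal (t / 2) < intervalMax g s}) := by
          gcongr
      _ ≤ 2 * (5 * ∫⁻ s, g s) := by
          gcongr 2 * ?_
          exact mul_volume_lt_intervalMax_le g (by simpa using ht) ENNReal.ofReal_ne_top
      _ = _ := by rw [← mul_assoc]; norm_num; rfl
  calc ∫⁻ s, intervalMax f s ^ 2
      ≤ ∫⁻ s, 4 * ∫⁻ t in Set.Ioi (0 : ℝ), ENNReal.ofReal t *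
          {t : ℝ | ENNReal.ofReal t < intervalMax f s}.indicator 1 t :=
        lintegral_mono fun s => sq_le_lintegral_indicator_lt _
    _ = 4 * ∫⁻ s, ∫⁻ t in Set.Ioi (0 : ℝ), ENNReal.ofReal t *
          {t : ℝ | ENNReal.ofReal t < intervalMax f s}.indicator 1 t :=
        lintegral_const_mul' _ _ (by simp)
    _ = 4 * ∫⁻ t in Set.Ioi (0 : ℝ), ∫⁻ s, ENNReal.ofReal t *
          {t : ℝ | ENNReal.ofReal t < intervalMax f s}.indicator 1 t := by
        rw [lintegral_lintegral_swap]
        have := hind hM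
        exact Measurable.aemeasurable (by unfold Function.uncurry; fun_prop)
    _ ≤ 4 * ∫⁻ t in Set.Ioi (0 : ℝ),
          10 * ∫⁻ s, f s * {t : ℝ | ENNReal.ofReal t < 2 * f s}.indicator 1 t := by
        gcongr 4 * ?_
        exact setLIntegral_mono' measurableSet_Ioi hlevel
    _ = 40 * ∫⁻ t in Set.Ioi (0 : ℝ),
          ∫⁻ s, f s * {t : ℝ | ENNReal.ofReal t < 2 * f s}.indicator 1 t := by
        rw [lintegral_const_mul' _ _ (by simp), ← mul_assoc]; norm_num
    _ = 40 * ∫⁻ s, ∫⁻ t in Set.Ioi (0 : ℝ),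
          f s * {t : ℝ | ENNReal.ofReal t < 2 * f s}.indicator 1 t := by
        rw [lintegral_lintegral_swap]
        exact ((hf.comp measurable_snd).mul ((hind h2f).comp measurable_swap)).aemeasurable
    _ ≤ 40 * ∫⁻ s, 2 * f s ^ 2 := by
        gcongr 40 * ?_
        refine lintegral_mono fun s => ?_
        have hm : MeasurableSet {t : ℝ | ENNReal.ofReal t < 2 * f s} :=
          measurableSet_lt ENNReal.measurable_ofReal measurable_const
        rw [lintegral_const_mul _ (measurable_one.indicator hm)]
        calc _ ≤ f s * (2 * f s) := by gcongr; exact volume_ofReal_lt_le _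
          _ = _ := by ring
    _ = 80 * ∫⁻ s, f s ^ 2 := by
        rw [lintegral_const_mul' _ _ (by simp), ← mul_assoc]; norm_num

/-! ### Averages over boxes, one variable at a time. -/

/-- The normalized Lebesgue measure on the interval `(a, b)`. -/
noncomputable def intervalMean (a b : ℝ) : Measure ℝ :=
  (ENNReal.ofReal (b - a))⁻¹ • volume.restrict (Set.Ioo a b)

instance (a b : ℝ) : SigmaFinite (intervalMean a b) := by
  by_cases h : a < b
  · have : IsFiniteMeasure (intervalMean a b) := by
      refine ⟨?_⟩
      simp only [intervalMean, Measure.smul_apply, Measure.restrict_apply_univ, Real.volume_Ioo,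
        smul_eq_mul]
      exact ENNReal.mul_lt_top (by simpa using h) ENNReal.ofReal_lt_top
    infer_instance
  · rw [intervalMean, Set.Ioo_eq_empty h, Measure.restrict_empty, smul_zero]
    infer_instance

theorem lintegral_intervalMean_le (f : ℝ → ℝ≥0∞) {a b t : ℝ} (ht : t ∈ Set.Ioo a b) :
    ∫⁻ s, f s ∂intervalMean a b ≤ 2 * intervalMax f t := by
  have hab : a < b := ht.1.trans ht.2
  -- Widening by less than half the length on each side reaches rational end points and at most
  -- doubles the length, hence the factor 2.
  obtain ⟨p, hp1, hp2⟩ := exists_rat_btwn (show a - (b - a) / 2 < a by linarith)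
  obtain ⟨q, hq1, hq2⟩ := exists_rat_btwn (show b < b + (b - a) / 2 by linarith)
  have h1 : ENNReal.ofReal (b - a) ≠ 0 := by simpa using hab
  have h2 : (ENNReal.ofReal (b - a))⁻¹ ≤ 2 * (ENNReal.ofReal (q - p))⁻¹ := by
    have hpq : 0 < (q : ℝ) - p := by linarith
    rw [← ENNReal.ofReal_inv_of_pos (by linarith), ← ENNReal.ofReal_inv_of_pos hpq,
      ← ENNReal.ofReal_ofNat, ← ENNReal.ofReal_mul (by norm_num)]
    refine ENNReal.ofReal_le_ofReal ?_
    rw [← div_eq_mul_inv, inv_eq_one_div, div_le_div_iff₀ (by linarith) hpq]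
    linarith
  rw [intervalMean, lintegral_smul_measure, smul_eq_mul]
  calc _ ≤ (2 * (ENNReal.ofReal (q - p))⁻¹) * ∫⁻ s in Set.Ioo (p : ℝ) q, f s := by
        gcongr
    _ = 2 * ((ENNReal.ofReal (q - p))⁻¹ * ∫⁻ s in Set.Ioo (p : ℝ) q, f s) := mul_assoc _ _ _
    _ ≤ _ := by
        gcongr
        refine le_iSup_of_le (p, q) ?_
        rw [Set.indicator_of_mem (show t ∈ Set.Ioo (p : ℝ) q from
          ⟨hp2.trans ht.1, ht.2.trans hq1⟩)]

/-- The uncentered maximal function with respect to the variable `i`. -/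
noncomputable def directionalMax {d : ℕ} (i : Fin d) (f : (Fin d → ℝ) → ℝ≥0∞) (x : Fin d → ℝ) :
    ℝ≥0∞ :=
  intervalMax (fun t => f (Function.update x i t)) (x i)

theorem measurable_directionalMax {d : ℕ} (i : Fin d) {f : (Fin d → ℝ) → ℝ≥0∞}
    (hf : Measurable f) : Measurable (directionalMax i f) := by
  refine Measurable.iSup fun p => ?_
  have h1 : Measurable fun x : Fin d → ℝ =>
      ∫⁻ s in Set.Ioo (p.1 : ℝ) p.2, f (Function.update x i s) := by
    simpa only [lmarginal_singleton] using
      hf.lmarginal (fun _ => volume.restrict (Set.Ioo (p.1 : ℝ) p.2)) (s := {i})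
  have h2 : MeasurableSet {x : Fin d → ℝ | x i ∈ Set.Ioo (p.1 : ℝ) p.2} :=
    measurable_pi_apply i measurableSet_Ioo
  exact ((h1.const_mul _).indicator h2 : Measurable ({x : Fin d → ℝ | x i ∈
    Set.Ioo (p.1 : ℝ) p.2}.indicator fun x => (ENNReal.ofReal (p.2 - p.1))⁻¹ *
      ∫⁻ s in Set.Ioo (p.1 : ℝ) p.2, f (Function.update x i s)))

theorem lintegral_directionalMax_sq_le {d : ℕ} (i : Fin d) {f : (Fin d → ℝ) → ℝ≥0∞}
    (hf : Measurable f) : ∫⁻ x, directionalMax i f x ^ 2 ≤ 80 * ∫⁻ x, f x ^ 2 := by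
  rw [← lintegral_const_mul' _ _ (by simp)]
  refine lintegral_le_of_lmarginal_le {i} ((measurable_directionalMax i hf).pow_const 2)
    ((hf.pow_const 2).const_mul 80) fun x => ?_
  simp only [lmarginal_singleton]
  rw [lintegral_const_mul' _ _ (by simp)]
  have hm : Measurable fun t => f (Function.update x i t) := by fun_prop
  simpa [directionalMax] using lintegral_intervalMax_sq_le hm

/-- The averages over the boxes containing a point, taken in the variables in `s`, have a
common majorant whose `L²` norm is controlled by that of the function. -/
theorem exists_majorant_lmarginal {d : ℕ} {f : (Fin d → ℝ) → ℝ≥0∞} (hf : Measurable f)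
    (s : Finset (Fin d)) :
    ∃ g : (Fin d → ℝ) → ℝ≥0∞, Measurable g ∧ ∫⁻ x, g x ^ 2 ≤ 320 ^ s.card * ∫⁻ x, f x ^ 2 ∧
      ∀ a b x : Fin d → ℝ, (∀ i ∈ s, x i ∈ Set.Ioo (a i) (b i)) →
        (∫⋯∫⁻_s, f ∂fun i => intervalMean (a i) (b i)) x ≤ g x := by
  induction s using Finset.induction with
  | empty => exact ⟨f, hf, by simp, by simp⟩
  | insert i s his ih =>
    obtain ⟨g, hg, hg2, hle⟩ := ih
    refine ⟨fun x => 2 * directionalMax i g x, (measurable_directionalMax i hg).const_mul 2,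
      ?_, fun a b x hx => ?_⟩
    · simp only [mul_pow]
      rw [lintegral_const_mul' _ _ (by simp), Finset.card_insert_of_notMem his, pow_succ]
      calc _ ≤ 2 ^ 2 * (80 * (320 ^ s.card * ∫⁻ x, f x ^ 2)) := by
            refine mul_le_mul_right ?_ _
            exact (lintegral_directionalMax_sq_le i hg).trans (by gcongr)
        _ = _ := by ring
    -- With variable `i` integrated last, the inner averages are at most `g`. The new factor is `320
    -- = 2² · 80`.
    · rw [lmarginal_insert _ hf his]
      calc _ ≤ ∫⁻ t, g (Function.update x i t) ∂intervalMean (a i) (b i) := by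
            refine lintegral_mono fun t => hle a b _ fun j hj => ?_
            rw [Function.update_of_ne (ne_of_mem_of_not_mem hj his)]
            exact hx j (Finset.mem_insert_of_mem hj)
        _ ≤ _ := lintegral_intervalMean_le _ (hx i (Finset.mem_insert_self i s))

theorem pi_intervalMean {d : ℕ} {a b : Fin d → ℝ} :
    Measure.pi (fun i => intervalMean (a i) (b i)) =
      (volume (Set.univ.pi fun i => Set.Ioo (a i) (b i)))⁻¹ •
        volume.restrict (Set.univ.pi fun i => Set.Ioo (a i) (b i)) := by
  refine Measure.pi_eq fun t ht => ?_
  rw [Measure.smul_apply, volume_pi, Measure.restrict_pi_pi, Measure.pi_pi, Measure.pi_pi,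
    smul_eq_mul, ENNReal.prod_inv_distrib, ← Finset.prod_mul_distrib]
  · simp [intervalMean, Real.volume_Ioo]
  · intro i _ j _ _
    right; simp

/-- The averages over the boxes containing a point have a common majorant whose `L²` norm is
controlled by that of the function. -/
theorem exists_majorant_average {d : ℕ} {f : (Fin d → ℝ) → ℝ≥0∞} (hf : Measurable f) :
    ∃ g : (Fin d → ℝ) → ℝ≥0∞, Measurable g ∧ ∫⁻ x, g x ^ 2 ≤ 320 ^ d * ∫⁻ x, f x ^ 2 ∧
      ∀ R ∈ axisRectangles d, ∀ x ∈ R, (volume R)⁻¹ * ∫⁻ y in R, f y ≤ g x := by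
  obtain ⟨g, hg, hg2, hle⟩ := exists_majorant_lmarginal hf Finset.univ
  refine ⟨g, hg, by simpa using hg2, ?_⟩
  rintro R ⟨a, b, -, rfl⟩ x hx
  have := hle a b x fun i _ => hx i trivial
  rwa [lmarginal_univ, pi_intervalMean, lintegral_smul_measure, smul_eq_mul] at this

/-! ### The multilinear estimate with a constant uniform in `p`. -/

theorem volume_axisRectangles_ne {d : ℕ} {R : Set (Fin d → ℝ)} (hR : R ∈ axisRectangles d) :
    volume R ≠ 0 ∧ volume R ≠ ∞ := by
  obtain ⟨a, b, hab, rfl⟩ := hR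
  rw [volume_pi, Measure.pi_pi]
  refine ⟨Finset.prod_ne_zero_iff.2 fun i _ => by simpa using hab i, ?_⟩
  exact ENNReal.prod_ne_top fun i _ => by simp

/-- Jensen's inequality, read off from the monotonicity of `L^q` norms over a probability measure.
-/
theorem average_rpow_le {α : Type*} [MeasurableSpace α] {μ : Measure α} {R : Set α}
    (h0 : μ R ≠ 0) (hR : μ R ≠ ∞) {f : α → ℝ≥0∞} (hf : AEMeasurable f μ) {q : ℝ} (hq : 1 ≤ q) :
    ((μ R)⁻¹ * ∫⁻ y in R, f y ∂μ) ^ q ≤ (μ R)⁻¹ * ∫⁻ y in R, f y ^ q ∂μ := by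
  have : IsProbabilityMeasure ((μ R)⁻¹ • μ.restrict R) :=
    ⟨by simp [ENNReal.inv_mul_cancel h0 hR]⟩
  have hq0 : 0 < q := by linarith
  have h := eLpNorm'_le_eLpNorm'_of_exponent_le (f := f) zero_lt_one hq ((μ R)⁻¹ • μ.restrict R)
    ((hf.restrict.smul_measure _).aestronglyMeasurable)
  simp only [eLpNorm', enorm_eq_self, ENNReal.rpow_one, div_one, lintegral_smul_measure,
    smul_eq_mul] at h
  rwa [one_div, ENNReal.le_rpow_inv_iff hq0] at h

/-- Superlevel sets are unions of open rectangles, so no regularity of `f` is needed. -/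
theorem measurable_strongMaximal {𝕜 : Type*} [ENorm 𝕜] {d : ℕ} (f : Fin d → (Fin d → ℝ) → 𝕜) :
    Measurable (strongMaximal f) := by
  refine measurable_of_Ioi fun c => IsOpen.measurableSet ?_
  have : strongMaximal f ⁻¹' Set.Ioi c = ⋃ R ∈ {R ∈ axisRectangles d |
      c < ∏ i, ((volume R)⁻¹ * ∫⁻ y in R, ‖f i y‖ₑ)}, R := by
    ext x
    simp only [strongMaximal, Set.mem_preimage, Set.mem_Ioi, lt_iSup_iff, Set.mem_iUnion,
      Set.mem_ofPred_eq, exists_prop]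
    tauto
  rw [this]
  refine isOpen_biUnion ?_
  rintro R ⟨⟨a, b, -, rfl⟩, -⟩
  exact isOpen_set_pi Set.finite_univ fun _ _ => isOpen_Ioo

theorem lintegral_strongMaximal_rpow_le {𝕜 : Type*} [NormedAddCommGroup 𝕜] {d : ℕ} (hd : 2 ≤ d)
    {f : Fin d → (Fin d → ℝ) → 𝕜} (hf : ∀ i, AEStronglyMeasurable (f i) volume) {p : ℝ}
    (hp : 1 ≤ p) :
    ∫⁻ x, strongMaximal f x ^ p ≤
      320 ^ d * ∏ i, (∫⁻ x, ‖f i x‖ₑ ^ ((d : ℝ) * p)) ^ (1 / (d : ℝ)) := by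
  have hd' : (2 : ℝ) ≤ d := by exact_mod_cast hd
  have hd0 : (0 : ℝ) < d := by linarith
  -- Chosen so that the `L²` bound for `|f_i|^q` involves exactly the exponent `2q = dp`.
  set q : ℝ := d * p / 2 with hq
  have hq1 : 1 ≤ q := by rw [hq]; nlinarith
  -- The majorant requires a genuinely measurable function; passing to a representative changes no
  -- integral.
  have hm (i : Fin d) : Measurable fun x => ‖(hf i).mk (f i) x‖ₑ ^ q :=
    (hf i).stronglyMeasurable_mk.enorm.pow_const q
  choose g hg hg2 hle using fun i => exists_majorant_average (hm i)
  have hint (i : Fin d) : ∫⁻ x, (‖(hf i).mk (f i) x‖ₑ ^ q) ^ 2 =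
      ∫⁻ x, ‖f i x‖ₑ ^ ((d : ℝ) * p) := by
    refine lintegral_congr_ae ?_
    filter_upwards [(hf i).ae_eq_mk] with x hx
    rw [← hx, ← ENNReal.rpow_natCast, ← ENNReal.rpow_mul]
    congr 1
    simp [hq]
  have hpt (x : Fin d → ℝ) : strongMaximal f x ^ p ≤ ∏ i, (g i x ^ 2) ^ (1 / (d : ℝ)) := by
    rw [← ENNReal.le_rpow_inv_iff (by linarith)]
    refine iSup₂_le fun R ⟨hR, hx⟩ => ?_
    rw [ENNReal.le_rpow_inv_iff (by linarith), ← ENNReal.prod_rpow_of_nonneg (by linarith)]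
    refine Finset.prod_le_prod' fun i _ => ?_
    obtain ⟨h0, htop⟩ := volume_axisRectangles_ne hR
    have h1 : ((volume R)⁻¹ * ∫⁻ y in R, ‖f i y‖ₑ) ^ q ≤ g i x := by
      refine (average_rpow_le h0 htop (hf i).enorm hq1).trans ?_
      refine le_trans (le_of_eq ?_) (hle i R hR x hx)
      congr 1
      refine lintegral_congr_ae (ae_restrict_of_ae ?_)
      filter_upwards [(hf i).ae_eq_mk] with y hy
      rw [← hy]
    -- The exponents agree because `2q/d = p`.
    calc _ = ((((volume R)⁻¹ * ∫⁻ y in R, ‖f i y‖ₑ) ^ q) ^ 2) ^ (1 / (d : ℝ)) := by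
          rw [← ENNReal.rpow_natCast, ← ENNReal.rpow_mul, ← ENNReal.rpow_mul]
          congr 1
          rw [hq]; push_cast; field_simp
      _ ≤ _ := by gcongr
  have hsum : ∑ _i : Fin d, 1 / (d : ℝ) = 1 := by simp [hd0.ne']
  calc ∫⁻ x, strongMaximal f x ^ p ≤ ∫⁻ x, ∏ i, (g i x ^ 2) ^ (1 / (d : ℝ)) := lintegral_mono hpt
    _ ≤ ∏ i, (∫⁻ x, g i x ^ 2) ^ (1 / (d : ℝ)) :=
        ENNReal.lintegral_prod_norm_pow_le Finset.univ
          (fun i _ => ((hg i).pow_const 2).aemeasurable) hsum (fun _ _ => by positivity)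
    _ ≤ ∏ i, (320 ^ d * ∫⁻ x, ‖f i x‖ₑ ^ ((d : ℝ) * p)) ^ (1 / (d : ℝ)) := by
        gcongr with i
        exact (hg2 i).trans_eq (by rw [hint])
    _ = _ := by
        simp_rw [ENNReal.mul_rpow_of_nonneg _ _ (show 0 ≤ 1 / (d : ℝ) by positivity)]
        rw [Finset.prod_mul_distrib, Finset.prod_const, Finset.card_univ, Fintype.card_fin,
          ← ENNReal.rpow_natCast ((_ : ℝ≥0∞) ^ (1 / (d : ℝ))), ← ENNReal.rpow_mul,
          one_div_mul_cancel hd0.ne', ENNReal.rpow_one]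

theorem eLpNorm_ofReal_exponent {Z ε : Type*} [MeasurableSpace Z] [ENorm ε] {ν : Measure Z} (f : Z → ε)
    {p : ℝ} (hp : 0 < p) :
    eLpNorm f (ENNReal.ofReal p) ν = (∫⁻ x, ‖f x‖ₑ ^ p ∂ν) ^ (1 / p) := by
  rw [eLpNorm_eq_lintegral_rpow_enorm_toReal (by simpa using hp) ENNReal.ofReal_ne_top,
    ENNReal.toReal_ofReal hp.le]

/-- Boundedness of the multilinear strong maximal operator from `L^{dp} × ⋯ × L^{dp}` to `L^p`,
with a constant that does not depend on `p`. -/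
theorem eLpNorm_strongMaximal_le {𝕜 : Type*} [NormedAddCommGroup 𝕜] {d : ℕ} (hd : 2 ≤ d)
    {f : Fin d → (Fin d → ℝ) → 𝕜} (hf : ∀ i, AEStronglyMeasurable (f i) volume) {p : ℝ}
    (hp : 1 ≤ p) :
    eLpNorm (strongMaximal f) (ENNReal.ofReal p) volume ≤
      320 ^ d * ∏ i, eLpNorm (f i) (ENNReal.ofReal (d * p)) volume := by
  have hd0 : (0 : ℝ) < d := by exact_mod_cast (by lia : 0 < d)
  have hp0 : 0 < p := by linarith
  have hdp : 0 < (d : ℝ) * p := by positivity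
  simp only [eLpNorm_ofReal_exponent _ hp0, eLpNorm_ofReal_exponent _ hdp, enorm_eq_self]
  calc _ ≤ (320 ^ d * ∏ i, (∫⁻ x, ‖f i x‖ₑ ^ ((d : ℝ) * p)) ^ (1 / (d : ℝ))) ^ (1 / p) := by
        gcongr; exact lintegral_strongMaximal_rpow_le hd hf hp
    _ = (320 ^ d) ^ (1 / p) * ∏ i, (∫⁻ x, ‖f i x‖ₑ ^ ((d : ℝ) * p)) ^ (1 / ((d : ℝ) * p)) := by
        rw [ENNReal.mul_rpow_of_nonneg _ _ (by positivity),
          ← ENNReal.prod_rpow_of_nonneg (by positivity)]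
        simp_rw [← ENNReal.rpow_mul]
        congr! 3
        rw [one_div_mul_one_div]
    _ ≤ _ := by
        gcongr
        calc _ ≤ (320 ^ d : ℝ≥0∞) ^ (1 : ℝ) :=
              ENNReal.rpow_le_rpow_of_exponent_le (one_le_pow₀ (by norm_num))
                (by rw [div_le_one hp0]; exact hp)
          _ = _ := ENNReal.rpow_one _

/-! ### The extremal problem. -/

theorem prod_le_pow_of_sum_eq {d : ℕ} (hd : 0 < d) {z : Fin d → ℝ} (hz : ∀ i, 0 ≤ z i) {c : ℝ}
    (h : ∑ i, z i = d * c) : ∏ i, z i ≤ c ^ d := by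
  have hd0 : (0 : ℝ) < d := by exact_mod_cast hd
  have h1 := Real.geom_mean_le_arith_mean Finset.univ (fun _ : Fin d => (1 : ℝ)) z
    (fun _ _ => zero_le_one) (by simpa using hd) fun i _ => hz i
  simp only [Real.rpow_one, Finset.sum_const, Finset.card_univ, Fintype.card_fin, nsmul_eq_mul,
    mul_one, one_mul, h] at h1
  rw [mul_div_cancel_left₀ _ hd0.ne'] at h1
  have hprod : 0 ≤ ∏ i, z i := Finset.prod_nonneg fun i _ => hz i
  calc ∏ i, z i = ((∏ i, z i) ^ (d : ℝ)⁻¹) ^ d := by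
        rw [← Real.rpow_natCast, ← Real.rpow_mul hprod, inv_mul_cancel₀ hd0.ne', Real.rpow_one]
    _ ≤ c ^ d := by gcongr

/-- With `u_i = 1/q_i` each factor is `(u_i^γ (1 - u_i))⁻¹`. The constraint fixes both `∑ u_i` and
`∑ (1 - u_i)`, so by AM-GM both products are largest at the same point, all `u_i = 1/(dp)`. -/
theorem isLeast_extremalValues {d : ℕ} (hd : 2 ≤ d) {γ p : ℝ} (hγ : 0 < γ) (hp : 1 ≤ p) :
    IsLeast (extremalValues d γ p) ((((d : ℝ) * p) ^ (γ + 1) / ((d : ℝ) * p - 1)) ^ d) := by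
  have hd' : (2 : ℝ) ≤ d := by exact_mod_cast hd
  have hd0 : (0 : ℝ) < d := by linarith
  have hdp : 1 < (d : ℝ) * p := by nlinarith
  have hval {q : ℝ} (hq : 1 < q) : q ^ (γ + 1) / (q - 1) = ((1 / q) ^ γ * (1 - 1 / q))⁻¹ := by
    have : q - 1 ≠ 0 := by linarith
    have hq0 : 0 < q := by linarith
    rw [Real.rpow_add hq0, Real.rpow_one, one_div, Real.inv_rpow hq0.le]
    have : q ^ γ ≠ 0 := (Real.rpow_pos_of_pos hq0 γ).ne'
    field_simp
  constructor
  · refine ⟨fun _ => d * p, fun _ => hdp, ?_, by simp [div_pow]⟩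
    simp only [Finset.sum_const, Finset.card_univ, Fintype.card_fin, nsmul_eq_mul]
    field_simp
  · rintro z ⟨q, hq, hsum, rfl⟩
    have hu (i : Fin d) : 0 < 1 / q i := by have := hq i; positivity
    have hu1 (i : Fin d) : 0 < 1 - 1 / q i := by
      have := hq i
      rw [sub_pos, div_lt_one (by linarith)]; exact this
    have h1 : ∏ i, 1 / q i ≤ (1 / (d * p)) ^ d := by
      refine prod_le_pow_of_sum_eq (by lia) (fun i => (hu i).le) ?_
      rw [hsum]; field_simp
    have h2 : ∏ i, (1 - 1 / q i) ≤ (1 - 1 / (d * p)) ^ d := by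
      refine prod_le_pow_of_sum_eq (by lia) (fun i => (hu1 i).le) ?_
      rw [Finset.sum_sub_distrib, hsum]
      simp only [Finset.sum_const, Finset.card_univ, Fintype.card_fin, nsmul_eq_mul]
      field_simp
    rw [hval hdp, Finset.prod_congr rfl fun i _ => hval (hq i), Finset.prod_inv_distrib, inv_pow]
    have h3 : 0 < ∏ i, (1 / q i) ^ γ * (1 - 1 / q i) := by
      refine Finset.prod_pos fun i _ => ?_
      have := hu i; have := hu1 i; positivity
    refine inv_anti₀ h3 ?_
    rw [Finset.prod_mul_distrib, mul_pow, Real.finsetProd_rpow _ _ fun i _ => (hu i).le,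
      ← Real.rpow_natCast ((1 / (d * p)) ^ γ), ← Real.rpow_mul (by positivity), mul_comm γ,
      Real.rpow_mul (by positivity), Real.rpow_natCast]
    have h4 : 0 ≤ ∏ i, 1 / q i := Finset.prod_nonneg fun i _ => (hu i).le
    have h5 : 0 ≤ ∏ i, (1 - 1 / q i) := Finset.prod_nonneg fun i _ => (hu1 i).le
    gcongr

/-- Since `dp ≥ 2`, the ratio `dp/(dp-1)` lies between 1 and 2. The upper bound also gives away a
factor `p^d`. -/
theorem extremalValue_bounds {d : ℕ} (hd : 2 ≤ d) (γ : ℝ) {p : ℝ} (hp : 1 ≤ p) :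
    (((d : ℝ) * p) ^ γ) ^ d ≤ (((d : ℝ) * p) ^ (γ + 1) / ((d : ℝ) * p - 1)) ^ d ∧
    (((d : ℝ) * p) ^ (γ + 1) / ((d : ℝ) * p - 1)) ^ d ≤
      2 ^ d * (d : ℝ) ^ ((d : ℝ) * γ) * p ^ ((d : ℝ) * (γ + 1)) := by
  have hd' : (2 : ℝ) ≤ d := by exact_mod_cast hd
  have hd0 : (0 : ℝ) < d := by linarith
  have hp0 : 0 < p := by linarith
  have hdp : 2 ≤ (d : ℝ) * p := by nlinarith
  have hdp1 : 0 < (d : ℝ) * p - 1 := by linarith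
  have hγ' : 0 < ((d : ℝ) * p) ^ γ := Real.rpow_pos_of_pos (by positivity) γ
  have hsplit : ((d : ℝ) * p) ^ (γ + 1) = ((d : ℝ) * p) ^ γ * (d * p) := by
    rw [Real.rpow_add (by positivity), Real.rpow_one]
  constructor
  · gcongr
    rw [le_div_iff₀ hdp1, hsplit]
    gcongr
    linarith
  · calc _ ≤ (2 * ((d : ℝ) * p) ^ γ) ^ d := by
          have : 0 ≤ ((d : ℝ) * p) ^ (γ + 1) := by positivity
          gcongr
          rw [div_le_iff₀ hdp1, hsplit]
          nlinarith
      _ = 2 ^ d * (d : ℝ) ^ ((d : ℝ) * γ) * p ^ ((d : ℝ) * γ) := by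
          rw [mul_pow, Real.mul_rpow hd0.le hp0.le, mul_pow, ← Real.rpow_mul_natCast hd0.le,
            ← Real.rpow_mul_natCast hp0.le, mul_comm γ, mul_assoc]
      _ ≤ _ := by
          gcongr
          linarith

/-! ### Passage to Grand Lebesgue norms. -/

theorem eLpNorm_le_glsPowNorm {Z ε : Type*} [MeasurableSpace Z] [ENorm ε] (γ : ℝ) (f : Z → ε)
    (ν : Measure Z) {p : ℝ} (hp : 1 ≤ p) :
    eLpNorm f (ENNReal.ofReal p) ν ≤ ENNReal.ofReal (p ^ γ) * glsPowNorm γ f ν := by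
  have h0 : 0 < p ^ γ := Real.rpow_pos_of_pos (by linarith) γ
  rw [mul_comm, ← ENNReal.div_le_iff_le_mul (Or.inl (by simpa using h0))
    (Or.inl ENNReal.ofReal_ne_top)]
  exact le_iSup₂_of_le p hp le_rfl

theorem mainTheorem6 (d : ℕ) (hd : 2 ≤ d) :
    ∃ C₁ C₂ : ℝ, 0 < C₁ ∧ 0 < C₂ ∧ ∀ γ : ℝ, 0 < γ →
      -- the extremal problem and the bound for its minimum
      (∀ p : ℝ, 1 ≤ p →
        ∃ Z : ℝ, Z = (((d : ℝ) * p) ^ (γ + 1) / ((d : ℝ) * p - 1)) ^ d ∧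
          IsLeast (extremalValues d γ p) Z ∧
          Z ≤ C₁ * (d : ℝ) ^ ((d : ℝ) * γ) * p ^ ((d : ℝ) * (γ + 1))) ∧
      -- the estimates for the maximal operator
      ∀ (𝕜 : Type*) [RCLike 𝕜] (f : Fin d → (Fin d → ℝ) → 𝕜),
        (∀ i, MemGLSPow γ (f i) volume) →
          (∀ᵐ x, strongMaximal f x < ∞) ∧
          MemGLSPow ((d : ℝ) * (γ + 1)) (strongMaximal f) volume ∧
          (∀ p : ℝ, 1 ≤ p →
            eLpNorm (strongMaximal f) (ENNReal.ofReal p) volume ≤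
                ENNReal.ofReal (C₂ * sInf (extremalValues d γ p)) *
                  ∏ i, glsPowNorm γ (f i) volume ∧
            eLpNorm (strongMaximal f) (ENNReal.ofReal p) volume ≤
                ENNReal.ofReal (C₂ * (d : ℝ) ^ ((d : ℝ) * γ) * p ^ ((d : ℝ) * (γ + 1))) *
                  ∏ i, glsPowNorm γ (f i) volume) ∧
          glsPowNorm ((d : ℝ) * (γ + 1)) (strongMaximal f) volume ≤
            ENNReal.ofReal (C₂ * (d : ℝ) ^ ((d : ℝ) * γ)) *
              ∏ i, glsPowNorm γ (f i) volume := by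
  refine ⟨2 ^ d, 320 ^ d * 2 ^ d, by positivity, by positivity, fun γ hγ => ⟨fun p hp =>
    ⟨_, rfl, isLeast_extremalValues hd hγ hp, (extremalValue_bounds hd γ hp).2⟩, ?_⟩⟩
  intro 𝕜 _ f hf
  have hd1 : (1 : ℝ) ≤ d := by exact_mod_cast (by lia : 1 ≤ d)
  have hN : ∏ i, glsPowNorm γ (f i) volume ≠ ∞ := ENNReal.prod_ne_top fun i _ => (hf i).2.ne
  have hbase (p : ℝ) (hp : 1 ≤ p) : eLpNorm (strongMaximal f) (ENNReal.ofReal p) volume ≤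
      ENNReal.ofReal (320 ^ d * (((d : ℝ) * p) ^ γ) ^ d) * ∏ i, glsPowNorm γ (f i) volume := by
    have hdp : 1 ≤ (d : ℝ) * p := one_le_mul_of_one_le_of_one_le hd1 hp
    calc _ ≤ 320 ^ d * ∏ i, eLpNorm (f i) (ENNReal.ofReal (d * p)) volume :=
          eLpNorm_strongMaximal_le hd (fun i => (hf i).1) hp
      _ ≤ 320 ^ d * ∏ i, (ENNReal.ofReal (((d : ℝ) * p) ^ γ) * glsPowNorm γ (f i) volume) := by
          gcongr with i
          exact eLpNorm_le_glsPowNorm γ (f i) volume hdp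
      _ = _ := by
          rw [Finset.prod_mul_distrib, Finset.prod_const, Finset.card_univ, Fintype.card_fin,
            ← mul_assoc, ENNReal.ofReal_mul (by positivity), ENNReal.ofReal_pow (by norm_num),
            ENNReal.ofReal_pow (by positivity), ENNReal.ofReal_ofNat]
  have hZ (p : ℝ) (hp : 1 ≤ p) : eLpNorm (strongMaximal f) (ENNReal.ofReal p) volume ≤
      ENNReal.ofReal (320 ^ d * 2 ^ d * sInf (extremalValues d γ p)) *
        ∏ i, glsPowNorm γ (f i) volume := by
    rw [(isLeast_extremalValues hd hγ hp).csInf_eq]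
    refine (hbase p hp).trans ?_
    have h1 := (extremalValue_bounds hd γ hp).1
    gcongr
    -- Here `320^d` alone would do; the extra `2^d` lets one constant serve both estimates.
    exact le_mul_of_one_le_right (by positivity) (one_le_pow₀ (by norm_num))
  have hpow (p : ℝ) (hp : 1 ≤ p) : eLpNorm (strongMaximal f) (ENNReal.ofReal p) volume ≤
      ENNReal.ofReal (320 ^ d * 2 ^ d * (d : ℝ) ^ ((d : ℝ) * γ) * p ^ ((d : ℝ) * (γ + 1))) *
        ∏ i, glsPowNorm γ (f i) volume := by
    refine (hbase p hp).trans ?_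
    refine mul_le_mul_left (ENNReal.ofReal_le_ofReal ?_) _
    have h := (extremalValue_bounds hd γ hp).1.trans (extremalValue_bounds hd γ hp).2
    calc _ ≤ 320 ^ d * (2 ^ d * (d : ℝ) ^ ((d : ℝ) * γ) * p ^ ((d : ℝ) * (γ + 1))) := by gcongr
      _ = _ := by ring
  have hnorm : glsPowNorm ((d : ℝ) * (γ + 1)) (strongMaximal f) volume ≤
      ENNReal.ofReal (320 ^ d * 2 ^ d * (d : ℝ) ^ ((d : ℝ) * γ)) *
        ∏ i, glsPowNorm γ (f i) volume := by
    refine iSup₂_le fun p hp => ?_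
    have h0 : 0 < p ^ ((d : ℝ) * (γ + 1)) := Real.rpow_pos_of_pos (zero_lt_one.trans_le hp) _
    rw [ENNReal.div_le_iff_le_mul (Or.inl (by simpa using h0)) (Or.inl ENNReal.ofReal_ne_top)]
    refine (hpow p hp).trans_eq ?_
    rw [ENNReal.ofReal_mul (by positivity)]
    ring
  refine ⟨?_, ⟨(measurable_strongMaximal f).aestronglyMeasurable, hnorm.trans_lt
    (ENNReal.mul_lt_top ENNReal.ofReal_lt_top hN.lt_top)⟩, fun p hp => ⟨hZ p hp, hpow p hp⟩, hnorm⟩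
  -- The case `p = 1` makes the maximal function integrable, hence finite almost everywhere.
  have h1 := (hbase 1 le_rfl).trans_lt (ENNReal.mul_lt_top ENNReal.ofReal_lt_top hN.lt_top)
  rw [eLpNorm_ofReal_exponent _ one_pos] at h1
  simp only [enorm_eq_self, ENNReal.rpow_one, div_one] at h1
  exact ae_lt_top (measurable_strongMaximal f) h1.ne
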